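/- **Setting.** An episodic tabular MDP with horizon $H$ consists of finite sets $\mathcal S$ (states) and $\mathcal A$ (actions, non-empty), an initial distribution $\rho$ on $\mathcal S$, transition probabilities $P_h(\cdot\mid s,a)$ and rewards $r_h(s,a)\in[0,1]$ for $h=1,\dots,H$. A policy is a family $\pi=(\pi_h)_{h=1}^H$ of maps from states to probability distributions on $\mathcal A$. Rolling out $\pi$ produces a trajectory $(s_1,a_1,\dots,s_H,a_H)$ with $s_1\sim\rho$, $a_h\sim\pi_h(\cdot\mid s_h)$, $s_{h+1}\sim P_h(\cdot\mid s_h,a_h)$, and $V(\pi)=\mathbb E\big[\sum_{h=1}^H r_h(s_h,a_h)\big]$. Let $\pi^{E}$ be an expert policy (possibly, but not necessarily, deterministic), $\pi^\beta$ a behavior policy and $\eta\in(0,1]$. Data are collected in $N_{\mathrm{tot}}$ independent, identically distributed rounds: in each round one rolls out $\pi^{E}$ with probability $\eta$ (the trajectory goes to the expert dataset) and $\pi^\beta$ with probability $1-\eta$ (the trajectory goes to the supplementary dataset). Let $n_h(s,a)$ be the number of trajectories in the union of the two datasets (counted with multiplicity) that are at $(s,a)$ in step $h$, and $n_h(s)=\sum_a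 n_h(s,a)$. The policy $\pi^{\mathrm{NBCU}}$ is the maximum likelihood policy on the union dataset, $$\pi^{\mathrm{NBCU}}_h(a\mid s)=\frac{n_h(s,a)}{n_h(s)}\ \text{ if } n_h(s)>0,\qquad \pi^{\mathrm{NBCU}}_h(a\mid s)=\frac1{|\mathcal A|}\ \text{ otherwise.}$$ **Theorem.** There is a universal constant $C>0$, and for every horizon $H$ there is an integer $n_0\ge 1$ depending only on $H$, such that for all $\mathcal S$, $\mathcal A$, all MDPs, all policies $\pi^{E},\pi^\beta$ as above, all $\eta\in(0,1]$ and all $N_{\mathrm{tot}}\ge n_0$, $$\mathbb E\big[V(\pi^{E})-V(\pi^{\mathrm{NBCU}})\big]\ \le\ C\,\min\Big\{H,\ (1-\eta)\big(V(\pi^{E})-V(\pi^\beta)\big)+\frac{|\mathcal S|\,H^2\log N_{\mathrm{tot}}}{N_{\mathrm{tot}}}\Big\},$$ where the expectation is over the randomness of the data collection. -/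

import Mathlib

open scoped BigOperators

universe u v

noncomputable section

/-- An episodic tabular MDP with finite state space `S`, finite action space `A` and horizon `H`:
initial distribution `init` (`ρ`), time-dependent transition kernels `trans h s a` (`P_h(· | s, a)`)
and time-dependent rewards in `[0, 1]`. Time steps are indexed by `Fin H`. -/
structure TabularMDP (S : Type u) (A : Type v) [Fintype S] [Fintype A] (H : ℕ) where
  init : S → ℝ
  init_mem : init ∈ stdSimplex ℝ S
  trans : Fin H → S → A → S → ℝ
  trans_mem : ∀ h s a, trans h s a ∈ stdSimplex ℝ S
  reward : Fin H → S → A → ℝ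
  reward_mem : ∀ h s a, reward h s a ∈ Set.Icc (0 : ℝ) 1

/-- A time-dependent stochastic policy: `prob h s a` is `π_h(a | s)`. -/
structure TabularPolicy (S : Type u) (A : Type v) [Fintype A] (H : ℕ) where
  prob : Fin H → S → A → ℝ
  prob_mem : ∀ h s, prob h s ∈ stdSimplex ℝ A

/-- A trajectory `(s_1, a_1, …, s_H, a_H)`. -/
abbrev Trajectory (S : Type u) (A : Type v) (H : ℕ) : Type (max u v) := Fin H → S × A

namespace TabularMDP

variable {S : Type u} {A : Type v} [Fintype S] [Fintype A] {H : ℕ}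

/-- Conditional probability of the state of `τ` at step `h` given the preceding part of `τ`:
`ρ(s_1)` at the first step and `P_{h-1}(s_h | s_{h-1}, a_{h-1})` at later steps. -/
def stateProb (M : TabularMDP S A H) (τ : Trajectory S A H) (h : Fin H) : ℝ :=
  if (h : ℕ) = 0 then M.init (τ h).1
  else
    let k : Fin H := ⟨(h : ℕ) - 1, lt_of_le_of_lt (Nat.sub_le _ _) h.isLt⟩
    M.trans k (τ k).1 (τ k).2 (τ h).1

/-- Probability of the trajectory `τ` when the policy `π` is rolled out. -/
def trajProb (M : TabularMDP S A H) (π : TabularPolicy S A H) (τ : Trajectory S A H) : ℝ :=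
  ∏ h, M.stateProb τ h * π.prob h (τ h).1 (τ h).2

open Classical in
/-- The policy value `V(π)`: the expected total reward of a trajectory of `π`. -/
def value (M : TabularMDP S A H) (π : TabularPolicy S A H) : ℝ :=
  ∑ τ : Trajectory S A H, M.trajProb π τ * ∑ h, M.reward h (τ h).1 (τ h).2

end TabularMDP

/-- The outcome of `N` data collection rounds. Round `i` yields a label (`true` if the expert policy
was rolled out, `false` if the behavior policy was) and a trajectory. The expert dataset consists of
the trajectories with label `true`, the supplementary dataset of those with label `false`, and the
union dataset of all `N` trajectories, with multiplicity. -/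
abbrev CollectedData (S : Type u) (A : Type v) (H N : ℕ) : Type (max u v) :=
  Fin N → Bool × Trajectory S A H

namespace TabularMDP

variable {S : Type u} {A : Type v} [Fintype S] [Fintype A] {H : ℕ}

/-- Probability of the outcome of one round: with probability `η` the expert policy `πE` is rolled
out, with probability `1 - η` the behavior policy `πβ`. -/
def roundProb (M : TabularMDP S A H) (πE πβ : TabularPolicy S A H) (η : ℝ)
    (x : Bool × Trajectory S A H) : ℝ :=
  if x.1 = true then η * M.trajProb πE x.2 else (1 - η) * M.trajProb πβ x.2

/-- Probability of the outcome of `N` independent rounds. -/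
def dataProb (M : TabularMDP S A H) (πE πβ : TabularPolicy S A H) (η : ℝ) {N : ℕ}
    (D : CollectedData S A H N) : ℝ :=
  ∏ i, M.roundProb πE πβ η (D i)

open Classical in
/-- Expectation over the randomness of the data collection. -/
def dataExpectation (M : TabularMDP S A H) (πE πβ : TabularPolicy S A H) (η : ℝ) (N : ℕ)
    (f : CollectedData S A H N → ℝ) : ℝ :=
  ∑ D : CollectedData S A H N, M.dataProb πE πβ η D * f D

end TabularMDP

section NBCU

variable {S : Type u} {A : Type v} {H N : ℕ}

open Classical in
/-- `n_h^U(s, a)`: the number of trajectories in the union dataset that are at `(s, a)` at step `h`. -/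
def unionCount (D : CollectedData S A H N) (h : Fin H) (s : S) (a : A) : ℕ :=
  (Finset.univ.filter fun i : Fin N => (D i).2 h = (s, a)).card

/-- `n_h^U(s) = ∑ a, n_h^U(s, a)`. -/
def unionStateCount [Fintype A] (D : CollectedData S A H N) (h : Fin H) (s : S) : ℕ :=
  ∑ a, unionCount D h s a

/-- The NBCU policy: the tabular maximum likelihood estimate on the union dataset, i.e. the
empirical action frequencies at visited states and the uniform distribution at unvisited ones. -/
def nbcu [Fintype A] [Nonempty A] (D : CollectedData S A H N) : TabularPolicy S A H where
  prob h s a :=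
    if 0 < unionStateCount D h s then (unionCount D h s a : ℝ) / (unionStateCount D h s : ℝ)
    else 1 / (Fintype.card A : ℝ)
  prob_mem h s := by
    by_cases hs : 0 < unionStateCount D h s
    · have hs' : (unionStateCount D h s : ℝ) ≠ 0 := by exact_mod_cast hs.ne'
      simp only [hs, if_true]
      refine ⟨fun a => by positivity, ?_⟩
      rw [← Finset.sum_div, div_eq_one_iff_eq hs']
      simp [unionStateCount]
    · simp only [hs, if_false]
      refine ⟨fun a => by positivity, ?_⟩
      simp

end NBCU

end

/-! One round is a mixture of two rollouts with mean return `η V(πE) + (1 - η) V(πβ)`, so it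
suffices that NBCU loses only `O_H(|S| / N)` against this mixture; the factor `log N` then absorbs
the constant in `H`. The label correlates actions across steps, so the proof uses only that states
follow the kernels (`ControlledChain`).

The NBCU rollout is a flow of mass over the samples: start with `1 / N` each, push along the
transition laws, and split the mass arriving at a state evenly among the samples there. Capping the
weights at `2 ^ h / N` discards mass, so the flow stays below the NBCU occupancy and its reward
`gain` below the NBCU value (`sum_gain_le_value_nbcu`).

For the converse, `toGo` is the value of the Markov policy with the mixture's conditional action
laws; its mean is the mixture return (`sum_law_mul_toGo`). Telescoping it along the flow leaves two
errors per step. The mass lost to the cap is at most a multiple of `(m - n) ^ 2 / m`, with `n` the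
visits and `m` the sum of their conditional probabilities; its mean is at most `2 ^ h / N` per state
(`iidExpect_flow_sub_le`). The action residual has mean zero given the state, but the weights depend
on the same data. Leave-one-out weights remove this dependence (`iidExpect_wt_erase_mul_eq_zero`),
and the cap makes the change small (`sum_abs_wt_sub_wt_erase_self_le`). -/

/-! ### Resampling one coordinate of an i.i.d. dataset -/

section Resampling

theorem sum_sum_update_swap {ι X : Type*} [Fintype ι] [DecidableEq ι] [Fintype X] (i : ι)
    (F : (ι → X) → X → ℝ) :
    ∑ D, ∑ x, F D x = ∑ D, ∑ x, F (Function.update D i x) (D i) := by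
  have hinv : Function.Involutive
      (fun p : (ι → X) × X => (Function.update p.1 i p.2, p.1 i)) := by
    rintro ⟨D, x⟩
    simp
  rw [← Fintype.sum_prod_type', ← Fintype.sum_prod_type']
  exact (Equiv.sum_comp hinv.toPerm (fun p : (ι → X) × X => F p.1 p.2)).symm

/-- The expectation of `f` over `N` independent draws from the weights `μ`. -/
noncomputable def iidExpect {Ω : Type*} [Fintype Ω] (μ : Ω → ℝ) (N : ℕ)
    (f : (Fin N → Ω) → ℝ) : ℝ :=
  ∑ D : Fin N → Ω, (∏ i, μ (D i)) * f D

variable {Ω : Type*} [Fintype Ω] {μ : Ω → ℝ} {N : ℕ}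

theorem iidExpect_add (f g : (Fin N → Ω) → ℝ) :
    iidExpect μ N (fun D => f D + g D) = iidExpect μ N f + iidExpect μ N g := by
  simp [iidExpect, mul_add, Finset.sum_add_distrib]

theorem iidExpect_sub (f g : (Fin N → Ω) → ℝ) :
    iidExpect μ N (fun D => f D - g D) = iidExpect μ N f - iidExpect μ N g := by
  simp [iidExpect, mul_sub, Finset.sum_sub_distrib]

theorem iidExpect_const_mul (c : ℝ) (f : (Fin N → Ω) → ℝ) :
    iidExpect μ N (fun D => c * f D) = c * iidExpect μ N f := by
  simp only [iidExpect, Finset.mul_sum]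
  exact Finset.sum_congr rfl fun D _ => by ring

theorem iidExpect_sum {ι : Type*} (s : Finset ι) (f : ι → (Fin N → Ω) → ℝ) :
    iidExpect μ N (fun D => ∑ k ∈ s, f k D) = ∑ k ∈ s, iidExpect μ N (f k) := by
  simp only [iidExpect, Finset.mul_sum]
  exact Finset.sum_comm

theorem iidExpect_mono (hμ : ∀ ω, 0 ≤ μ ω) {f g : (Fin N → Ω) → ℝ} (h : ∀ D, f D ≤ g D) :
    iidExpect μ N f ≤ iidExpect μ N g :=
  Finset.sum_le_sum fun D _ =>
    mul_le_mul_of_nonneg_left (h D) (Finset.prod_nonneg fun _ _ => hμ _)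

theorem iidExpect_const (h1 : ∑ ω, μ ω = 1) (c : ℝ) : iidExpect μ N (fun _ => c) = c := by
  classical
  have h : ∑ D : Fin N → Ω, ∏ i, μ (D i) = 1 := by
    rw [← Fintype.prod_sum (fun (_ : Fin N) ω => μ ω)]
    simp [h1]
  rw [iidExpect, ← Finset.sum_mul]
  convert one_mul c

/-- Exchanging `D i` with a fresh draw is an involution that preserves the product weight. -/
theorem iidExpect_resample (h1 : ∑ ω, μ ω = 1) (i : Fin N) (f : (Fin N → Ω) → ℝ) :
    iidExpect μ N f = iidExpect μ N (fun D => ∑ ω, μ ω * f (Function.update D i ω)) := by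
  have hw : ∀ (D : Fin N → Ω) (ω : Ω),
      (∏ j, μ (Function.update D i ω j)) * μ (D i) = (∏ j, μ (D j)) * μ ω := by
    intro D ω
    rw [← Finset.mul_prod_erase _ (fun j => μ (Function.update D i ω j)) (Finset.mem_univ i),
      ← Finset.mul_prod_erase _ (fun j => μ (D j)) (Finset.mem_univ i)]
    rw [Finset.prod_congr rfl (fun j hj => by
      rw [Function.update_of_ne (Finset.ne_of_mem_erase hj)] :
      ∀ j ∈ Finset.univ.erase i, μ (Function.update D i ω j) = μ (D j))]
    simp only [Function.update_self]
    ring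
  have h := sum_sum_update_swap i
    (fun (D : Fin N → Ω) ω => (∏ j, μ (D j)) * μ ω * f D)
  simp only [hw] at h
  calc iidExpect μ N f = ∑ D : Fin N → Ω, ∑ ω, (∏ j, μ (D j)) * μ ω * f D := by
        refine Finset.sum_congr rfl fun D _ => ?_
        rw [← Finset.sum_mul, ← Finset.mul_sum, h1, mul_one]
    _ = _ := by
        rw [h]
        refine Finset.sum_congr rfl fun D _ => ?_
        rw [Finset.mul_sum]
        exact Finset.sum_congr rfl fun ω _ => by ring

end Resampling

/-! ### Processes with Markov state transitions and arbitrary actions -/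

/-- Observations `(s_h, a_h)` of a random outcome `ω`, with states driven by transition kernels:
given the observations before step `h`, the state at step `h` has law `init` if `h = 0` and
`trans (h - 1) (s_{h-1}, a_{h-1})` otherwise. The actions are unconstrained. -/
structure ControlledChain (Ω S A : Type*) [Fintype Ω] [Fintype S] (H : ℕ) where
  weight : Ω → ℝ
  weight_nonneg : ∀ ω, 0 ≤ weight ω
  weight_sum : ∑ ω, weight ω = 1
  obs : ℕ → Ω → S × A
  init : S → ℝ
  init_mem : init ∈ stdSimplex ℝ S
  trans : ℕ → S × A → S → ℝ
  trans_mem : ∀ h z, trans h z ∈ stdSimplex ℝ S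
  markov : ∀ h < H, ∀ s, ∀ φ : Ω → ℝ,
    (∀ ω ω', (∀ k < h, obs k ω = obs k ω') → φ ω = φ ω') →
    ∑ ω, weight ω * (Set.indicator {ω | (obs h ω).1 = s} 1 ω * φ ω) =
      ∑ ω, weight ω * ((match h with
        | 0 => init
        | k + 1 => trans k (obs k ω)) s * φ ω)

namespace ControlledChain

variable {Ω S A : Type*} [Fintype Ω] [Fintype S] {H : ℕ} (C : ControlledChain Ω S A H)

/-- The indicator of being in state `s` at step `h`. -/
noncomputable def ind (h : ℕ) (s : S) (ω : Ω) : ℝ :=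
  Set.indicator {ω | (C.obs h ω).1 = s} 1 ω

/-- The law of the state at step `h` given the previous observations. -/
def law (h : ℕ) (ω : Ω) : S → ℝ :=
  match h with
  | 0 => C.init
  | k + 1 => C.trans k (C.obs k ω)

theorem sum_weight_ind_mul {h : ℕ} (hh : h < H) (s : S) (φ : Ω → ℝ)
    (hφ : ∀ ω ω', (∀ k < h, C.obs k ω = C.obs k ω') → φ ω = φ ω') :
    ∑ ω, C.weight ω * (C.ind h s ω * φ ω) = ∑ ω, C.weight ω * (C.law h ω s * φ ω) :=
  C.markov h hh s φ hφ

theorem law_mem (h : ℕ) (ω : Ω) : C.law h ω ∈ stdSimplex ℝ S := by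
  cases h
  · exact C.init_mem
  · exact C.trans_mem _ _

theorem law_nonneg (h : ℕ) (ω : Ω) (s : S) : 0 ≤ C.law h ω s := (C.law_mem h ω).1 s

theorem sum_law (h : ℕ) (ω : Ω) : ∑ s, C.law h ω s = 1 := (C.law_mem h ω).2

theorem law_congr {h : ℕ} {ω ω' : Ω} (H : ∀ k < h, C.obs k ω = C.obs k ω') :
    C.law h ω = C.law h ω' := by
  cases h with
  | zero => rfl
  | succ k => simp only [law, H k (Nat.lt_succ_self k)]

theorem ind_eq_ite [DecidableEq S] (h : ℕ) (s : S) (ω : Ω) :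
    C.ind h s ω = if (C.obs h ω).1 = s then 1 else 0 := by
  simp [ind, Set.indicator_apply]

theorem ind_nonneg (h : ℕ) (s : S) (ω : Ω) : 0 ≤ C.ind h s ω := by
  classical
  rw [ind_eq_ite]; split_ifs <;> simp

theorem ind_sq (h : ℕ) (s : S) (ω : Ω) : C.ind h s ω * C.ind h s ω = C.ind h s ω := by
  classical
  rw [ind_eq_ite]; split_ifs <;> simp

theorem sum_ind_mul (h : ℕ) (ω : Ω) (f : S → ℝ) :
    ∑ s, C.ind h s ω * f s = f (C.obs h ω).1 := by
  classical
  simp [ind_eq_ite]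

/-! ### Capped sample weights and their leave-one-out stability -/

section Weights

variable {N : ℕ} (D : Fin N → Ω) (I : Finset (Fin N))

/-- The number of samples with index in `I` that are in state `s` at step `h`. -/
noncomputable def visits (h : ℕ) (s : S) : ℝ := ∑ j ∈ I, C.ind h s (D j)

/-- The state distribution at step `h` obtained by pushing sample weights `w` forward. -/
noncomputable def flow (w : Ω → ℝ) (h : ℕ) (s : S) : ℝ := ∑ j ∈ I, w (D j) * C.law h (D j) s

/-- Sharing `flow` evenly among the samples at `s`, each of them receiving at most
`2 ^ (h + 1) / N`. -/
noncomputable def share (w : Ω → ℝ) (h : ℕ) (s : S) : ℝ :=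
  min (C.flow D I w h s / C.visits D I h s) (2 ^ (h + 1) / N)

/-- The weight that the truncated imitator gives to a sample before step `h`. -/
noncomputable def wt : ℕ → Ω → ℝ
  | 0, _ => 1 / N
  | h + 1, ω => C.share D I (wt h) h (C.obs h ω).1

theorem visits_nonneg (h : ℕ) (s : S) : 0 ≤ C.visits D I h s :=
  Finset.sum_nonneg fun _ _ => C.ind_nonneg _ _ _

theorem flow_nonneg {w : Ω → ℝ} (hw : ∀ ω, 0 ≤ w ω) (h : ℕ) (s : S) : 0 ≤ C.flow D I w h s :=
  Finset.sum_nonneg fun _ _ => mul_nonneg (hw _) (C.law_nonneg _ _ _)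

theorem share_nonneg {w : Ω → ℝ} (hw : ∀ ω, 0 ≤ w ω) (h : ℕ) (s : S) : 0 ≤ C.share D I w h s :=
  le_min (div_nonneg (C.flow_nonneg D I hw h s) (C.visits_nonneg D I h s)) (by positivity)

theorem wt_nonneg (h : ℕ) (ω : Ω) : 0 ≤ C.wt D I h ω := by
  induction h generalizing ω with
  | zero => simp [wt]
  | succ h ih => exact C.share_nonneg D I ih h _

theorem wt_le (h : ℕ) (ω : Ω) : C.wt D I h ω ≤ 2 ^ h / N := by
  cases h with
  | zero => simp [wt]
  | succ h => exact min_le_right _ _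

theorem visits_mul_share {w : Ω → ℝ} (hw : ∀ ω, 0 ≤ w ω) (h : ℕ) (s : S) :
    C.visits D I h s * C.share D I w h s =
      min (C.flow D I w h s) (C.visits D I h s * (2 ^ (h + 1) / N)) := by
  -- With no sample at `s` both sides vanish: all mass arriving there is lost.
  rcases (C.visits_nonneg D I h s).eq_or_lt with h0 | h0
  · rw [← h0]
    simp [C.flow_nonneg D I hw h s]
  · rw [share, mul_min_of_nonneg _ _ h0.le, mul_div_cancel₀ _ h0.ne']

theorem sum_obs_eq_sum_visits_mul (h : ℕ) (f : S → ℝ) :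
    ∑ j ∈ I, f (C.obs h (D j)).1 = ∑ s, C.visits D I h s * f s := by
  simp only [visits, Finset.sum_mul]
  rw [Finset.sum_comm]
  exact Finset.sum_congr rfl fun j _ => (C.sum_ind_mul h (D j) f).symm

theorem visits_erase_add (i : Fin N) (h : ℕ) (s : S) :
    C.visits D Finset.univ h s = C.ind h s (D i) + C.visits D (Finset.univ.erase i) h s :=
  (Finset.add_sum_erase _ _ (Finset.mem_univ i)).symm

/-- Times its own count, a share is the minimum of the flow and the cap mass, and the minimum is
1-Lipschitz. The counts differ only by sample `i`, which costs one cap in this minimum and one more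
when the smaller count is replaced by the larger. -/
theorem visits_mul_abs_share_sub_le (i : Fin N) {w w' : Ω → ℝ} (hw : ∀ ω, 0 ≤ w ω)
    (hw' : ∀ ω, 0 ≤ w' ω) (h : ℕ) (s : S) :
    C.visits D Finset.univ h s *
        |C.share D Finset.univ w h s - C.share D (Finset.univ.erase i) w' h s| ≤
      |C.flow D Finset.univ w h s - C.flow D (Finset.univ.erase i) w' h s| +
        C.ind h s (D i) * (2 * (2 ^ (h + 1) / N)) := by
  have e1 := C.visits_mul_share D Finset.univ hw h s
  have e2 := C.visits_mul_share D (Finset.univ.erase i) hw' h s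
  have hv := C.visits_erase_add D i h s
  have hle : C.share D (Finset.univ.erase i) w' h s ≤ 2 ^ (h + 1) / N := min_le_right _ _
  have hnn := C.share_nonneg D (Finset.univ.erase i) hw' h s
  have hi := C.ind_nonneg h s (D i)
  have hm := abs_min_sub_min_le_max (C.flow D Finset.univ w h s)
    (C.visits D Finset.univ h s * (2 ^ (h + 1) / N))
    (C.flow D (Finset.univ.erase i) w' h s)
    (C.visits D (Finset.univ.erase i) h s * (2 ^ (h + 1) / N))
  have hK : (0 : ℝ) ≤ 2 ^ (h + 1) / N := by positivity
  set K : ℝ := 2 ^ (h + 1) / N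
  set W := C.share D Finset.univ w h s
  set W' := C.share D (Finset.univ.erase i) w' h s
  set n := C.visits D Finset.univ h s
  set n' := C.visits D (Finset.univ.erase i) h s
  set b := C.ind h s (D i)
  have h3 : n * K - n' * K = b * K := by rw [hv]; ring
  rw [← e1, ← e2, h3, abs_of_nonneg (mul_nonneg hi hK)] at hm
  have h4 := max_le_add_of_nonneg
    (abs_nonneg (C.flow D Finset.univ w h s - C.flow D (Finset.univ.erase i) w' h s))
    (mul_nonneg hi hK)
  have h5 : n * |W - W'| = |(n * W - n' * W') - b * W'| := by
    have hn : 0 ≤ n := C.visits_nonneg D Finset.univ h s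
    rw [show n * W - n' * W' - b * W' = n * (W - W') by rw [hv]; ring, abs_mul, abs_of_nonneg hn]
  have h6 := abs_sub (n * W - n' * W') (b * W')
  rw [abs_of_nonneg (mul_nonneg hi hnn)] at h6
  have h7 : b * W' ≤ b * K := mul_le_mul_of_nonneg_left hle hi
  rw [h5]
  linarith

/-- Pushing weights through probability laws does not expand `ℓ¹` distance; `w (D i)` is the mass of
the omitted sample. -/
theorem sum_abs_flow_sub_le (i : Fin N) {w w' : Ω → ℝ} (hw : ∀ ω, 0 ≤ w ω) (h : ℕ) :
    ∑ s, |C.flow D Finset.univ w h s - C.flow D (Finset.univ.erase i) w' h s| ≤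
      w (D i) + ∑ j, |w (D j) - w' (D j)| := by
  have h1 : ∀ s, |C.flow D Finset.univ w h s - C.flow D (Finset.univ.erase i) w' h s| ≤
      w (D i) * C.law h (D i) s +
        ∑ j ∈ Finset.univ.erase i, |w (D j) - w' (D j)| * C.law h (D j) s := by
    intro s
    rw [flow, ← Finset.add_sum_erase _ _ (Finset.mem_univ i), flow, add_sub_assoc,
      ← Finset.sum_sub_distrib]
    refine (abs_add_le _ _).trans (add_le_add ?_ ?_)
    · rw [abs_of_nonneg (mul_nonneg (hw _) (C.law_nonneg _ _ _))]
    · refine (Finset.abs_sum_le_sum_abs _ _).trans (Finset.sum_le_sum fun j _ => ?_)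
      rw [← sub_mul, abs_mul, abs_of_nonneg (C.law_nonneg h (D j) s)]
  refine (Finset.sum_le_sum fun s _ => h1 s).trans ?_
  rw [Finset.sum_add_distrib, Finset.sum_comm]
  simp only [← Finset.mul_sum, C.sum_law, mul_one]
  exact add_le_add le_rfl (Finset.sum_le_sum_of_subset_of_nonneg (Finset.erase_subset _ _)
    fun _ _ _ => abs_nonneg _)

theorem sum_abs_wt_sub_wt_erase_le (i : Fin N) (h : ℕ) :
    ∑ j, |C.wt D Finset.univ h (D j) - C.wt D (Finset.univ.erase i) h (D j)| ≤
      5 * (2 ^ h / N) := by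
  induction h with
  | zero => simp [wt]
  | succ h ih =>
    have h1 := C.sum_obs_eq_sum_visits_mul D Finset.univ h (fun s =>
      |C.share D Finset.univ (C.wt D Finset.univ h) h s -
        C.share D (Finset.univ.erase i) (C.wt D (Finset.univ.erase i) h) h s|)
    simp only [wt]
    rw [h1]
    refine (Finset.sum_le_sum fun s _ => C.visits_mul_abs_share_sub_le D i
      (C.wt_nonneg D _ h) (C.wt_nonneg D _ h) h s).trans ?_
    rw [Finset.sum_add_distrib, C.sum_ind_mul h (D i) (fun _ => 2 * (2 ^ (h + 1) / (N : ℝ)))]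
    have h2 := C.sum_abs_flow_sub_le D i (w' := C.wt D (Finset.univ.erase i) h)
      (C.wt_nonneg D Finset.univ h) h
    have h3 := C.wt_le D Finset.univ h (D i)
    -- In units of `2 ^ h / N`: omitted mass 1, previous discrepancy 5, two caps 4. The total 10 is
    -- 5 in units of `2 ^ (h + 1) / N`.
    have h4 : (2 : ℝ) ^ (h + 1) / N = 2 * (2 ^ h / N) := by ring
    rw [h4]
    linarith

theorem sum_inv_visits_le (h : ℕ) :
    ∑ j, (C.visits D Finset.univ h (C.obs h (D j)).1)⁻¹ ≤ Fintype.card S := by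
  rw [C.sum_obs_eq_sum_visits_mul D Finset.univ h (fun s => (C.visits D Finset.univ h s)⁻¹)]
  refine (Finset.sum_le_sum fun s _ => mul_inv_le_one).trans ?_
  simp

/-- All samples in the state of sample `i` carry the same discrepancy, so its own is at most the
total divided by the visits there; these inverse counts add up to at most `|S|`. -/
theorem sum_abs_wt_sub_wt_erase_self_le (h : ℕ) :
    ∑ i, |C.wt D Finset.univ (h + 1) (D i) - C.wt D (Finset.univ.erase i) (h + 1) (D i)| ≤
      5 * (2 ^ (h + 1) / N) * Fintype.card S := by
  refine le_trans (Finset.sum_le_sum fun i _ => ?_)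
    ((Finset.mul_sum _ _ _).symm.trans_le (mul_le_mul_of_nonneg_left (C.sum_inv_visits_le D h)
      (by positivity)))
  have h1 := C.sum_abs_wt_sub_wt_erase_le D i (h + 1)
  have h2 := C.sum_obs_eq_sum_visits_mul D Finset.univ h (fun s =>
      |C.share D Finset.univ (C.wt D Finset.univ h) h s -
        C.share D (Finset.univ.erase i) (C.wt D (Finset.univ.erase i) h) h s|)
  simp only [wt] at h1 ⊢
  rw [h2] at h1
  have h3 := (Finset.single_le_sum (f := fun s => C.visits D Finset.univ h s *
      |C.share D Finset.univ (C.wt D Finset.univ h) h s -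
        C.share D (Finset.univ.erase i) (C.wt D (Finset.univ.erase i) h) h s|)
    (fun s _ => mul_nonneg (C.visits_nonneg D _ h s) (abs_nonneg _))
    (Finset.mem_univ (C.obs h (D i)).1)).trans h1
  have hpos : 0 < C.visits D Finset.univ h (C.obs h (D i)).1 := by
    classical
    have := C.visits_erase_add D i h (C.obs h (D i)).1
    rw [C.ind_eq_ite, if_pos rfl] at this
    have := C.visits_nonneg D (Finset.univ.erase i) h (C.obs h (D i)).1
    linarith
  rw [← div_eq_mul_inv, le_div_iff₀ hpos, mul_comm]
  exact h3

end Weights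

end ControlledChain

namespace ControlledChain

variable {Ω S A : Type*} [Fintype Ω] [Fintype S] {H : ℕ} (C : ControlledChain Ω S A H)

/-! ### Bias from reusing the data, by leave-one-out -/

section Bias

variable {N : ℕ}

theorem wt_congr {D D' : Fin N → Ω} {I : Finset (Fin N)} (hD : ∀ j ∈ I, D j = D' j) (h : ℕ) :
    C.wt D I h = C.wt D' I h := by
  induction h with
  | zero => rfl
  | succ h ih =>
    have hf : C.flow D I (C.wt D I h) h = C.flow D' I (C.wt D' I h) h := by
      funext s
      exact Finset.sum_congr rfl fun j hj => by rw [hD j hj, ih]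
    have hv : C.visits D I h = C.visits D' I h := by
      funext s
      exact Finset.sum_congr rfl fun j hj => by rw [hD j hj]
    funext ω
    simp only [wt, share, hf, hv]

/-- The share rule built without sample `i` is independent of it, so its weight depends on `D i`
only through the state at step `h`, given which `G` is centred. -/
theorem iidExpect_wt_erase_mul_eq_zero (h : ℕ) (G : S × A → ℝ)
    (hG : ∀ s, ∑ ω, C.weight ω * (C.ind h s ω * G (C.obs h ω)) = 0) (i : Fin N) :
    iidExpect C.weight N (fun D =>
      C.wt D (Finset.univ.erase i) (h + 1) (D i) * G (C.obs h (D i))) = 0 := by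
  rw [iidExpect_resample C.weight_sum i]
  refine Finset.sum_eq_zero fun D _ => mul_eq_zero_of_right _ ?_
  have h1 : ∀ ω, C.weight ω * (C.wt (Function.update D i ω) (Finset.univ.erase i) (h + 1)
      (Function.update D i ω i) * G (C.obs h (Function.update D i ω i))) =
      ∑ s, C.share D (Finset.univ.erase i) (C.wt D (Finset.univ.erase i) h) h s *
        (C.weight ω * (C.ind h s ω * G (C.obs h ω))) := by
    intro ω
    rw [C.wt_congr (D' := D) (fun j hj => Function.update_of_ne (Finset.ne_of_mem_erase hj) _ _),
      Function.update_self]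
    simp only [wt]
    rw [← C.sum_ind_mul h ω (C.share D (Finset.univ.erase i)
      (C.wt D (Finset.univ.erase i) h) h), Finset.sum_mul, Finset.mul_sum]
    exact Finset.sum_congr rfl fun s _ => by ring
  simp only [h1]
  rw [Finset.sum_comm]
  simp only [← Finset.mul_sum, hG, mul_zero, Finset.sum_const_zero]

theorem iidExpect_sum_wt_mul_le (h : ℕ) (G : S × A → ℝ) {B : ℝ} (hB : ∀ z, |G z| ≤ B)
    (hB0 : 0 ≤ B)
    (hG : ∀ s, ∑ ω, C.weight ω * (C.ind h s ω * G (C.obs h ω)) = 0) :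
    iidExpect C.weight N (fun D => ∑ j, C.wt D Finset.univ (h + 1) (D j) * G (C.obs h (D j))) ≤
      B * (5 * (2 ^ (h + 1) / N) * Fintype.card S) := by
  have h1 : ∀ D : Fin N → Ω,
      ∑ j, C.wt D Finset.univ (h + 1) (D j) * G (C.obs h (D j)) ≤
        ∑ j, C.wt D (Finset.univ.erase j) (h + 1) (D j) * G (C.obs h (D j)) +
          B * (5 * (2 ^ (h + 1) / N) * Fintype.card S) := by
    intro D
    refine le_trans ?_ (add_le_add le_rfl (mul_le_mul_of_nonneg_left
      (C.sum_abs_wt_sub_wt_erase_self_le D h) hB0))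
    rw [Finset.mul_sum, ← Finset.sum_add_distrib]
    refine Finset.sum_le_sum fun j _ => ?_
    rw [← sub_le_iff_le_add', ← sub_mul]
    refine (le_abs_self _).trans ?_
    rw [abs_mul, mul_comm]
    exact mul_le_mul_of_nonneg_right (hB _) (abs_nonneg _)
  refine (iidExpect_mono C.weight_nonneg h1).trans ?_
  rw [iidExpect_add, iidExpect_const C.weight_sum, iidExpect_sum,
    Finset.sum_eq_zero fun j _ => C.iidExpect_wt_erase_mul_eq_zero h G hG j, zero_add]

end Bias

/-! ### Mass lost to the cap -/

section Truncation

variable {N : ℕ}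

/-- The sum of the conditional probabilities that the samples are in state `s` at step `h`. -/
def meanVisits (D : Fin N → Ω) (h : ℕ) (s : S) : ℝ := ∑ j, C.law h (D j) s

theorem meanVisits_nonneg (D : Fin N → Ω) (h : ℕ) (s : S) : 0 ≤ C.meanVisits D h s :=
  Finset.sum_nonneg fun _ _ => C.law_nonneg _ _ _

theorem meanVisits_update_congr (D : Fin N → Ω) (i : Fin N) {h : ℕ} (s : S) {ω ω' : Ω}
    (hω : ∀ k < h, C.obs k ω = C.obs k ω') :
    C.meanVisits (Function.update D i ω) h s = C.meanVisits (Function.update D i ω') h s := by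
  refine Finset.sum_congr rfl fun j _ => ?_
  by_cases hj : j = i
  · subst hj
    simp only [Function.update_self, C.law_congr hω]
  · simp only [Function.update_of_ne hj]

/-- When sample `i` is redrawn, `meanVisits` sees only its past before step `h`; given that past,
`law - ind` has mean zero. -/
theorem iidExpect_cross_eq_zero {h : ℕ} (hh : h < H) (s : S) {i j : Fin N} (hij : j ≠ i) :
    iidExpect C.weight N (fun D => (C.law h (D i) s - C.ind h s (D i)) *
      (C.law h (D j) s - C.ind h s (D j)) * (C.meanVisits D h s)⁻¹) = 0 := by
  rw [iidExpect_resample C.weight_sum i]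
  refine Finset.sum_eq_zero fun D _ => mul_eq_zero_of_right _ ?_
  simp only [Function.update_self, Function.update_of_ne hij]
  have h1 := C.sum_weight_ind_mul hh s (fun ω => (C.law h (D j) s - C.ind h s (D j)) *
    (C.meanVisits (Function.update D i ω) h s)⁻¹)
    (fun ω ω' hω => by rw [C.meanVisits_update_congr D i s hω])
  rw [← sub_eq_zero, ← Finset.sum_sub_distrib] at h1
  rw [← neg_eq_zero, ← h1, ← Finset.sum_neg_distrib]
  exact Finset.sum_congr rfl fun ω _ => by ring

/-- Bernoulli variance: given the past, the square of `law - ind` has mean `p - p ^ 2 ≤ p`, where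
`p` is the law at `s`. -/
theorem iidExpect_diag_le {h : ℕ} (hh : h < H) (s : S) (i : Fin N) :
    iidExpect C.weight N (fun D => (C.law h (D i) s - C.ind h s (D i)) *
      (C.law h (D i) s - C.ind h s (D i)) * (C.meanVisits D h s)⁻¹) ≤
    iidExpect C.weight N (fun D => C.law h (D i) s * (C.meanVisits D h s)⁻¹) := by
  rw [iidExpect_resample C.weight_sum i, iidExpect_resample C.weight_sum i (fun D =>
    C.law h (D i) s * (C.meanVisits D h s)⁻¹)]
  refine iidExpect_mono C.weight_nonneg fun D => ?_
  simp only [Function.update_self]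
  have h1 := C.sum_weight_ind_mul hh s (fun ω => (1 - 2 * C.law h ω s) *
    (C.meanVisits (Function.update D i ω) h s)⁻¹)
    (fun ω ω' hω => by rw [C.meanVisits_update_congr D i s hω, C.law_congr hω])
  have h2 : ∀ ω, C.weight ω * ((C.law h ω s - C.ind h s ω) * (C.law h ω s - C.ind h s ω) *
      (C.meanVisits (Function.update D i ω) h s)⁻¹) =
      C.weight ω * (C.ind h s ω * ((1 - 2 * C.law h ω s) *
        (C.meanVisits (Function.update D i ω) h s)⁻¹)) +
      C.weight ω * (C.law h ω s * C.law h ω s *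
        (C.meanVisits (Function.update D i ω) h s)⁻¹) := by
    intro ω
    linear_combination C.weight ω * (C.meanVisits (Function.update D i ω) h s)⁻¹ * C.ind_sq h s ω
  simp only [h2, Finset.sum_add_distrib]
  rw [h1, ← Finset.sum_add_distrib]
  refine Finset.sum_le_sum fun ω _ => ?_
  rw [← mul_add]
  refine mul_le_mul_of_nonneg_left ?_ (C.weight_nonneg ω)
  have h3 : 0 ≤ C.law h ω s * C.law h ω s * (C.meanVisits (Function.update D i ω) h s)⁻¹ :=
    mul_nonneg (mul_self_nonneg _) (inv_nonneg.2 (C.meanVisits_nonneg _ _ _))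
  nlinarith

/-- Only the diagonal of the expanded square survives, and the conditional probabilities in it add
up to `meanVisits`, which cancels the denominator. -/
theorem iidExpect_sq_visits_sub_div_le_one {h : ℕ} (hh : h < H) (s : S) :
    iidExpect C.weight N (fun D =>
      (C.meanVisits D h s - C.visits D Finset.univ h s) ^ 2 * (C.meanVisits D h s)⁻¹) ≤ 1 := by
  have h1 : ∀ D : Fin N → Ω,
      (C.meanVisits D h s - C.visits D Finset.univ h s) ^ 2 * (C.meanVisits D h s)⁻¹ =
      ∑ i, ∑ j, (C.law h (D i) s - C.ind h s (D i)) *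
        (C.law h (D j) s - C.ind h s (D j)) * (C.meanVisits D h s)⁻¹ := by
    intro D
    simp only [← Finset.sum_mul, ← Finset.mul_sum, Finset.sum_sub_distrib]
    rw [pow_two]
    rfl
  simp only [h1]
  rw [iidExpect_sum]
  have h2 : ∀ i : Fin N, iidExpect C.weight N (fun D =>
      ∑ j, (C.law h (D i) s - C.ind h s (D i)) *
        (C.law h (D j) s - C.ind h s (D j)) * (C.meanVisits D h s)⁻¹) ≤
      iidExpect C.weight N (fun D => C.law h (D i) s * (C.meanVisits D h s)⁻¹) := by
    intro i
    rw [iidExpect_sum, Finset.sum_eq_single i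
      (fun j _ hj => C.iidExpect_cross_eq_zero hh s hj) (by simp)]
    exact C.iidExpect_diag_le hh s i
  refine (Finset.sum_le_sum fun i _ => h2 i).trans ?_
  rw [← iidExpect_sum]
  refine (iidExpect_mono C.weight_nonneg (g := fun _ => 1) fun D => ?_).trans
    (iidExpect_const C.weight_sum 1).le
  rw [← Finset.sum_mul]
  exact mul_inv_le_one

theorem flow_sub_visits_mul_share_le (D : Fin N → Ω) (h : ℕ) (s : S) :
    C.flow D Finset.univ (C.wt D Finset.univ h) h s -
      C.visits D Finset.univ h s * C.share D Finset.univ (C.wt D Finset.univ h) h s ≤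
    2 ^ h / N * ((C.meanVisits D h s - C.visits D Finset.univ h s) ^ 2 *
      (C.meanVisits D h s)⁻¹) := by
  rw [C.visits_mul_share D _ (C.wt_nonneg D _ h)]
  have hK : (0 : ℝ) ≤ 2 ^ h / N := by positivity
  have hf : C.flow D Finset.univ (C.wt D Finset.univ h) h s ≤ 2 ^ h / N * C.meanVisits D h s := by
    rw [meanVisits, Finset.mul_sum]
    exact Finset.sum_le_sum fun j _ =>
      mul_le_mul_of_nonneg_right (C.wt_le D _ h _) (C.law_nonneg _ _ _)
  have hm := C.meanVisits_nonneg D h s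
  have h4 : (2 : ℝ) ^ (h + 1) / N = 2 * (2 ^ h / N) := by ring
  rw [h4]
  set f := C.flow D Finset.univ (C.wt D Finset.univ h) h s
  set m := C.meanVisits D h s
  set n := C.visits D Finset.univ h s
  set K : ℝ := 2 ^ h / N
  have hr : 0 ≤ K * ((m - n) ^ 2 * m⁻¹) :=
    mul_nonneg hK (mul_nonneg (sq_nonneg _) (inv_nonneg.2 hm))
  rcases le_total f (n * (2 * K)) with hfn | hfn
  · rwa [min_eq_left hfn, sub_self]
  rw [min_eq_right hfn]
  -- If `m = 0` then `f ≤ 0`, so nothing is lost and the convention `0⁻¹ = 0` is harmless.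
  rcases hm.eq_or_lt with hm0 | hm0
  · have hn : 0 ≤ n := C.visits_nonneg D _ h s
    rw [← hm0] at hf hr ⊢
    nlinarith [mul_nonneg hn hK]
  · have h5 : m - 2 * n ≤ (m - n) ^ 2 * m⁻¹ := by
      rw [← div_eq_mul_inv, le_div_iff₀ hm0]
      nlinarith [sq_nonneg n]
    nlinarith [mul_le_mul_of_nonneg_left h5 hK]

theorem iidExpect_flow_sub_le {h : ℕ} (hh : h < H) (s : S) :
    iidExpect C.weight N (fun D => C.flow D Finset.univ (C.wt D Finset.univ h) h s -
      C.visits D Finset.univ h s * C.share D Finset.univ (C.wt D Finset.univ h) h s) ≤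
    2 ^ h / N := by
  refine (iidExpect_mono C.weight_nonneg fun D => C.flow_sub_visits_mul_share_le D h s).trans ?_
  rw [iidExpect_const_mul]
  exact mul_le_of_le_one_right (by positivity) (C.iidExpect_sq_visits_sub_div_le_one hh s)

end Truncation

/-! ### Value of the conditional Markov policy and telescoping along the flow -/

section ValueToGo

/-- The conditional mean of `f (s_h, a_h)` given `s_h = s`. -/
noncomputable def condMean (h : ℕ) (f : S × A → ℝ) (s : S) : ℝ :=
  (∑ ω, C.weight ω * (C.ind h s ω * f (C.obs h ω))) / ∑ ω, C.weight ω * C.ind h s ω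

theorem prob_mul_condMean (h : ℕ) (f : S × A → ℝ) (s : S) :
    (∑ ω, C.weight ω * C.ind h s ω) * C.condMean h f s =
      ∑ ω, C.weight ω * (C.ind h s ω * f (C.obs h ω)) := by
  by_cases h0 : ∑ ω, C.weight ω * C.ind h s ω = 0
  · rw [h0, zero_mul]
    have h1 := (Finset.sum_eq_zero_iff_of_nonneg fun ω _ =>
      mul_nonneg (C.weight_nonneg ω) (C.ind_nonneg h s ω)).1 h0
    exact (Finset.sum_eq_zero fun ω hω => by rw [← mul_assoc, h1 ω hω, zero_mul]).symm
  · rw [condMean, mul_div_cancel₀ _ h0]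

theorem condMean_mem (h : ℕ) {f : S × A → ℝ} {B : ℝ} (hB : 0 ≤ B)
    (hf : ∀ z, f z ∈ Set.Icc 0 B) (s : S) : C.condMean h f s ∈ Set.Icc 0 B := by
  have hw : ∀ ω, 0 ≤ C.weight ω * C.ind h s ω := fun ω =>
    mul_nonneg (C.weight_nonneg ω) (C.ind_nonneg h s ω)
  refine ⟨div_nonneg (Finset.sum_nonneg fun ω _ => ?_) (Finset.sum_nonneg fun ω _ => hw ω),
    div_le_of_le_mul₀ (Finset.sum_nonneg fun ω _ => hw ω) hB ?_⟩
  · rw [← mul_assoc]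
    exact mul_nonneg (hw ω) (hf _).1
  · rw [Finset.mul_sum]
    refine Finset.sum_le_sum fun ω _ => ?_
    rw [← mul_assoc, mul_comm B]
    exact mul_le_mul_of_nonneg_left (hf _).2 (hw ω)

/-- Reward at step `h` plus the mean of `U` at the next state. -/
def lookahead (r : ℕ → S × A → ℝ) (h : ℕ) (U : S → ℝ) (z : S × A) : ℝ :=
  r h z + ∑ s, C.trans h z s * U s

/-- Expected reward over the `n` steps from step `h` on for the Markov policy that plays the
conditional law of the action given the state. -/
noncomputable def toGo (r : ℕ → S × A → ℝ) : ℕ → ℕ → S → ℝ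
  | 0, _, _ => 0
  | n + 1, h, s => C.condMean h (C.lookahead r h (toGo r n (h + 1))) s

variable {r : ℕ → S × A → ℝ} (hr : ∀ h z, r h z ∈ Set.Icc (0 : ℝ) 1)

include hr in
theorem lookahead_mem (h : ℕ) {U : S → ℝ} {B : ℝ} (hU : ∀ s, U s ∈ Set.Icc 0 B) (z : S × A) :
    C.lookahead r h U z ∈ Set.Icc 0 (B + 1) := by
  have hp := C.trans_mem h z
  refine ⟨add_nonneg (hr h z).1 (Finset.sum_nonneg fun s _ => mul_nonneg (hp.1 s) (hU s).1), ?_⟩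
  rw [add_comm B]
  refine add_le_add (hr h z).2 ((Finset.sum_le_sum fun s _ =>
    mul_le_mul_of_nonneg_left (hU s).2 (hp.1 s)).trans ?_)
  rw [← Finset.sum_mul, hp.2, one_mul]

include hr in
theorem toGo_mem (n h : ℕ) (s : S) : C.toGo r n h s ∈ Set.Icc (0 : ℝ) n := by
  induction n generalizing h s with
  | zero => simp [toGo]
  | succ n ih =>
    push_cast
    exact C.condMean_mem h (by positivity) (C.lookahead_mem hr h (ih (h + 1))) s

/-- Replacing the actions by their conditional law given the state keeps the mean return, because
rewards and transitions depend only on the current pair: weighting `condMean` by the visit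
probability restores the true expectation. -/
theorem sum_law_mul_toGo (n h : ℕ) (hn : h + n ≤ H) :
    ∑ ω, C.weight ω * ∑ s, C.law h ω s * C.toGo r n h s =
      ∑ ω, C.weight ω * ∑ k ∈ Finset.range n, r (h + k) (C.obs (h + k) ω) := by
  induction n generalizing h with
  | zero => simp [toGo]
  | succ n ih =>
    have h1 : ∀ s, ∑ ω, C.weight ω * C.law h ω s = ∑ ω, C.weight ω * C.ind h s ω := by
      intro s
      simpa using (C.sum_weight_ind_mul (by omega : h < H) s (fun _ => 1)
        (fun _ _ _ => rfl)).symm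
    have h2 := ih (h + 1) (by omega)
    calc _ = ∑ s, (∑ ω, C.weight ω * C.law h ω s) * C.toGo r (n + 1) h s := by
          simp only [Finset.mul_sum, Finset.sum_mul]
          rw [Finset.sum_comm]
          simp only [mul_assoc]
      _ = ∑ ω, C.weight ω * C.lookahead r h (C.toGo r n (h + 1)) (C.obs h ω) := by
          simp only [h1, toGo, prob_mul_condMean]
          rw [Finset.sum_comm]
          refine Finset.sum_congr rfl fun ω _ => ?_
          rw [← Finset.mul_sum, ← Finset.sum_mul]
          have := C.sum_ind_mul h ω (fun _ => 1)
          simp only [mul_one] at this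
          rw [this, one_mul]
      _ = ∑ ω, C.weight ω * r h (C.obs h ω) +
            ∑ ω, C.weight ω * ∑ s, C.law (h + 1) ω s * C.toGo r n (h + 1) s := by
          rw [← Finset.sum_add_distrib]
          exact Finset.sum_congr rfl fun ω _ => mul_add _ _ _
      _ = _ := by
          rw [h2, ← Finset.sum_add_distrib]
          refine Finset.sum_congr rfl fun ω _ => ?_
          rw [← mul_add, Finset.sum_range_succ', add_comm]
          simp only [add_zero, add_assoc, add_comm 1]

/-- The reward collected by the truncated imitator at step `h`. -/
noncomputable def gain {N : ℕ} (r : ℕ → S × A → ℝ) (D : Fin N → Ω) (h : ℕ) : ℝ :=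
  ∑ j, C.wt D Finset.univ (h + 1) (D j) * r h (C.obs h (D j))

/-- One step of the telescoping: mass lost to the cap, action residual, collected reward, remaining
flow. -/
theorem sum_flow_mul_toGo_succ {N : ℕ} (D : Fin N → Ω) (n h : ℕ) :
    ∑ s, C.flow D Finset.univ (C.wt D Finset.univ h) h s * C.toGo r (n + 1) h s =
      ∑ s, C.toGo r (n + 1) h s * (C.flow D Finset.univ (C.wt D Finset.univ h) h s -
        C.visits D Finset.univ h s * C.share D Finset.univ (C.wt D Finset.univ h) h s) +
      ∑ j, C.wt D Finset.univ (h + 1) (D j) * (C.toGo r (n + 1) h (C.obs h (D j)).1 -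
        C.lookahead r h (C.toGo r n (h + 1)) (C.obs h (D j))) +
      C.gain r D h +
      ∑ s, C.flow D Finset.univ (C.wt D Finset.univ (h + 1)) (h + 1) s * C.toGo r n (h + 1) s := by
  have h1 := C.sum_obs_eq_sum_visits_mul D Finset.univ h (fun s =>
    C.share D Finset.univ (C.wt D Finset.univ h) h s * C.toGo r (n + 1) h s)
  have h2 : ∑ s, C.flow D Finset.univ (C.wt D Finset.univ (h + 1)) (h + 1) s *
      C.toGo r n (h + 1) s = ∑ j, C.wt D Finset.univ (h + 1) (D j) *
        ∑ s, C.trans h (C.obs h (D j)) s * C.toGo r n (h + 1) s := by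
    simp only [flow, Finset.sum_mul, Finset.mul_sum]
    rw [Finset.sum_comm]
    simp only [law, mul_assoc]
  have h3 : ∑ j, C.wt D Finset.univ (h + 1) (D j) * (C.toGo r (n + 1) h (C.obs h (D j)).1 -
        C.lookahead r h (C.toGo r n (h + 1)) (C.obs h (D j))) +
      C.gain r D h + ∑ j, C.wt D Finset.univ (h + 1) (D j) *
        ∑ s, C.trans h (C.obs h (D j)) s * C.toGo r n (h + 1) s =
      ∑ j, C.share D Finset.univ (C.wt D Finset.univ h) h (C.obs h (D j)).1 *
        C.toGo r (n + 1) h (C.obs h (D j)).1 := by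
    rw [gain, ← Finset.sum_add_distrib, ← Finset.sum_add_distrib]
    refine Finset.sum_congr rfl fun j _ => ?_
    simp only [lookahead, wt]
    ring
  have h4 : ∑ s, C.flow D Finset.univ (C.wt D Finset.univ h) h s * C.toGo r (n + 1) h s =
      ∑ s, C.toGo r (n + 1) h s * (C.flow D Finset.univ (C.wt D Finset.univ h) h s -
        C.visits D Finset.univ h s * C.share D Finset.univ (C.wt D Finset.univ h) h s) +
      ∑ s, C.visits D Finset.univ h s *
        (C.share D Finset.univ (C.wt D Finset.univ h) h s * C.toGo r (n + 1) h s) := by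
    rw [← Finset.sum_add_distrib]
    exact Finset.sum_congr rfl fun s _ => by ring
  linarith

include hr in
-- The constant 11 is 1 for the lost mass plus 10 for the bias, namely `5 * 2 ^ (h + 1)` in units of
-- `2 ^ h`.
theorem iidExpect_flow_mul_toGo_le {N : ℕ} (n h : ℕ) (hn : h + n ≤ H) :
    iidExpect C.weight N (fun D =>
      ∑ s, C.flow D Finset.univ (C.wt D Finset.univ h) h s * C.toGo r n h s) ≤
    iidExpect C.weight N (fun D => ∑ k ∈ Finset.range n, C.gain r D (h + k)) +
      ∑ k ∈ Finset.range n, 11 * (H : ℝ) * Fintype.card S * (2 ^ (h + k) / N) := by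
  induction n generalizing h with
  | zero => simp [toGo]
  | succ n ih =>
    have hnH : ((n + 1 : ℕ) : ℝ) ≤ H := by exact_mod_cast (by omega : n + 1 ≤ H)
    have hH : (0 : ℝ) ≤ H := Nat.cast_nonneg _
    have hU : ∀ s, C.toGo r (n + 1) h s ∈ Set.Icc (0 : ℝ) H := fun s =>
      ⟨(C.toGo_mem hr (n + 1) h s).1, (C.toGo_mem hr (n + 1) h s).2.trans hnH⟩
    have hQ : ∀ z, C.lookahead r h (C.toGo r n (h + 1)) z ∈ Set.Icc (0 : ℝ) H := fun z => by
      have := C.lookahead_mem hr h (C.toGo_mem hr n (h + 1)) z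
      push_cast at hnH
      exact ⟨this.1, this.2.trans hnH⟩
    have hkill : iidExpect C.weight N (fun D => ∑ s, C.toGo r (n + 1) h s *
        (C.flow D Finset.univ (C.wt D Finset.univ h) h s - C.visits D Finset.univ h s *
          C.share D Finset.univ (C.wt D Finset.univ h) h s)) ≤
        H * Fintype.card S * (2 ^ h / N) := by
      rw [iidExpect_sum]
      have : ∀ s ∈ Finset.univ, iidExpect C.weight N (fun D => C.toGo r (n + 1) h s *
          (C.flow D Finset.univ (C.wt D Finset.univ h) h s - C.visits D Finset.univ h s *
            C.share D Finset.univ (C.wt D Finset.univ h) h s)) ≤ H * (2 ^ h / N) := by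
        intro s _
        rw [iidExpect_const_mul]
        exact (mul_le_mul_of_nonneg_left (C.iidExpect_flow_sub_le (by omega) s) (hU s).1).trans
          (mul_le_mul_of_nonneg_right (hU s).2 (by positivity))
      refine (Finset.sum_le_sum this).trans (le_of_eq ?_)
      rw [Finset.sum_const, Finset.card_univ, nsmul_eq_mul]
      ring
    have hbias := C.iidExpect_sum_wt_mul_le (N := N) h
      (fun z => C.toGo r (n + 1) h z.1 - C.lookahead r h (C.toGo r n (h + 1)) z) (B := H)
      (fun z => by
        have h1 := hU z.1
        have h2 := hQ z
        rw [abs_le]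
        constructor <;> linarith [h1.1, h1.2, h2.1, h2.2]) hH
      -- The residual is centred given the state, since `toGo` is the conditional mean of
      -- `lookahead`.
      (fun s => by
        have h1 := C.prob_mul_condMean h (C.lookahead r h (C.toGo r n (h + 1))) s
        rw [Finset.sum_mul, ← sub_eq_zero, ← Finset.sum_sub_distrib] at h1
        rw [← h1]
        refine Finset.sum_congr rfl fun ω _ => ?_
        classical
        by_cases hs : (C.obs h ω).1 = s
        · subst hs
          simp only [toGo]
          ring
        · simp [C.ind_eq_ite, hs])
    have h2 := ih (h + 1) (by omega)
    simp only [C.sum_flow_mul_toGo_succ]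
    rw [iidExpect_add, iidExpect_add, iidExpect_add]
    simp only [Finset.sum_range_succ' _ n, add_zero]
    rw [iidExpect_add]
    simp only [add_assoc, add_comm 1] at h2 ⊢
    have h5 : (H : ℝ) * (5 * (2 ^ (h + 1) / N) * Fintype.card S) =
      10 * H * Fintype.card S * (2 ^ h / N) := by ring
    linarith

include hr in
/-- The expected return of the process exceeds the expected return of the truncated imitator
by `O(|S| / N)`, with a constant that depends on the horizon only. -/
theorem sum_reward_sub_iidExpect_gain_le {N : ℕ} (hN : 0 < N) :
    ∑ ω, C.weight ω * ∑ k ∈ Finset.range H, r k (C.obs k ω) -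
      iidExpect C.weight N (fun D => ∑ k ∈ Finset.range H, C.gain r D k) ≤
    11 * H * 2 ^ H * (Fintype.card S / N) := by
  have h1 := C.iidExpect_flow_mul_toGo_le hr (N := N) H 0 (by omega)
  have h2 := C.sum_law_mul_toGo (r := r) H 0 (by omega)
  have hN' : (N : ℝ) ≠ 0 := by exact_mod_cast hN.ne'
  have h3 : ∀ D : Fin N → Ω,
      ∑ s, C.flow D Finset.univ (C.wt D Finset.univ 0) 0 s * C.toGo r H 0 s =
        ∑ s, C.init s * C.toGo r H 0 s := by
    intro D
    refine Finset.sum_congr rfl fun s _ => ?_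
    congr 1
    simp only [flow, wt, law, Finset.sum_const, Finset.card_univ, Fintype.card_fin, nsmul_eq_mul]
    field_simp
  simp only [h3, zero_add, iidExpect_const C.weight_sum] at h1
  simp only [law, zero_add, ← Finset.sum_mul, C.weight_sum, one_mul] at h2
  have h4 : ∑ k ∈ Finset.range H, 11 * (H : ℝ) * Fintype.card S * (2 ^ k / N) ≤
      11 * H * 2 ^ H * (Fintype.card S / N) := by
    have h5 : ∑ k ∈ Finset.range H, (2 : ℝ) ^ k ≤ 2 ^ H := by
      rw [geom_sum_eq (by norm_num)]
      norm_num
    rw [← Finset.mul_sum, ← Finset.sum_div]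
    have h6 := mul_le_mul_of_nonneg_left h5
      (by positivity : (0 : ℝ) ≤ 11 * H * (Fintype.card S / N))
    calc _ = 11 * (H : ℝ) * (Fintype.card S / N) * ∑ k ∈ Finset.range H, (2 : ℝ) ^ k := by ring
      _ ≤ _ := h6
      _ = _ := by ring
  linarith

end ValueToGo

end ControlledChain

/-! ### Products of sequential kernels as path laws -/

section SequentialKernels

variable {X : Type*} [Fintype X] {H : ℕ} {c : Fin H → (Fin H → X) → X → ℝ}

theorem card_mul_sum_kernel_step (h : Fin H) (ψ : (Fin H → X) → ℝ) (G : X → ℝ)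
    (hψ : ∀ τ x, ψ (Function.update τ h x) = ψ τ)
    (hc : ∀ τ x, c h (Function.update τ h x) = c h τ) :
    Fintype.card X * ∑ τ : Fin H → X, ψ τ * (c h τ (τ h) * G (τ h)) =
      ∑ τ : Fin H → X, ψ τ * ∑ x, c h τ x * G x := by
  have h1 := sum_sum_update_swap h (fun (τ : Fin H → X) (_ : X) => ψ τ * (c h τ (τ h) * G (τ h)))
  simp only [Finset.sum_const, Finset.card_univ, nsmul_eq_mul, hψ, hc, Function.update_self,
    ← Finset.mul_sum] at h1
  exact h1

/-- The product of the kernels before step `m`. -/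
def kernelProd (c : Fin H → (Fin H → X) → X → ℝ) (m : ℕ) (τ : Fin H → X) : ℝ :=
  ∏ k ∈ Finset.univ.filter (fun k : Fin H => (k : ℕ) < m), c k τ (τ k)

omit [Fintype X] in
theorem kernelProd_update (hc : ∀ h τ τ', (∀ k < h, τ k = τ' k) → c h τ = c h τ')
    (h : Fin H) (τ : Fin H → X) (x : X) :
    kernelProd c h (Function.update τ h x) = kernelProd c h τ := by
  refine Finset.prod_congr rfl fun k hk => ?_
  have hk' : k < h := (Finset.mem_filter.1 hk).2
  rw [Function.update_of_ne hk'.ne, hc k _ τ fun l hl =>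
    Function.update_of_ne (hl.trans hk').ne _ _]

omit [Fintype X] in
theorem kernelProd_succ (h : Fin H) (τ : Fin H → X) :
    kernelProd c (h + 1) τ = kernelProd c h τ * c h τ (τ h) := by
  have : Finset.univ.filter (fun k : Fin H => (k : ℕ) < h + 1) =
      insert h (Finset.univ.filter (fun k : Fin H => (k : ℕ) < h)) := by
    ext k
    simp only [Finset.mem_filter, Finset.mem_univ, true_and, Finset.mem_insert, Fin.ext_iff]
    omega
  rw [kernelProd, this, Finset.prod_insert (by simp), mul_comm]
  rfl

omit [Fintype X] in
theorem kernelProd_horizon (τ : Fin H → X) : kernelProd c H τ = ∏ k, c k τ (τ k) := by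
  simp [kernelProd]

/-- Completing a prefix product by one kernel replaces a free coordinate, counted `card X` times, by
one that integrates to 1. -/
theorem sum_kernelProd_mul (hc : ∀ h τ τ', (∀ k < h, τ k = τ' k) → c h τ = c h τ')
    (hc1 : ∀ h τ, ∑ x, c h τ x = 1) (n m : ℕ) (hm : m + n = H) (φ : (Fin H → X) → ℝ)
    (hφ : ∀ τ τ', (∀ k : Fin H, (k : ℕ) < m → τ k = τ' k) → φ τ = φ τ') :
    ∑ τ, kernelProd c m τ * φ τ =
      (Fintype.card X : ℝ) ^ n * ∑ τ, (∏ k, c k τ (τ k)) * φ τ := by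
  induction n generalizing m with
  | zero =>
    obtain rfl : m = H := hm
    simp [kernelProd_horizon]
  | succ n ih =>
    have h1 := ih (m + 1) (by omega) (fun τ τ' h => hφ τ τ' fun k hk => h k (by omega))
    have hmH : m < H := by omega
    have h2 := card_mul_sum_kernel_step (c := c) ⟨m, hmH⟩ (fun τ => kernelProd c m τ * φ τ)
      (fun _ => 1)
      (fun τ x => by
        rw [kernelProd_update hc ⟨m, hmH⟩ τ x, hφ _ τ fun k hk =>
          Function.update_of_ne (fun h => by simp [h] at hk) _ _])
      (fun τ x => hc _ _ _ fun k hk => Function.update_of_ne hk.ne _ _)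
    simp only [mul_one, hc1] at h2
    rw [← h2, pow_succ', mul_assoc, ← h1]
    congr 1
    refine Finset.sum_congr rfl fun τ _ => ?_
    rw [kernelProd_succ ⟨m, hmH⟩ τ]
    ring

theorem sum_prod_kernel_eq_one [Nonempty X]
    (hc : ∀ h τ τ', (∀ k < h, τ k = τ' k) → c h τ = c h τ')
    (hc1 : ∀ h τ, ∑ x, c h τ x = 1) : ∑ τ : Fin H → X, ∏ k, c k τ (τ k) = 1 := by
  have h1 := sum_kernelProd_mul hc hc1 H 0 (by omega) (fun _ => 1) (fun _ _ _ => rfl)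
  have h0 : (Fintype.card X : ℝ) ^ H ≠ 0 := pow_ne_zero _ (by simp)
  simp only [kernelProd, Nat.not_lt_zero, Finset.filter_false, Finset.prod_empty, mul_one,
    Finset.sum_const, Finset.card_univ, Fintype.card_pi, Finset.prod_const, Fintype.card_fin,
    nsmul_eq_mul] at h1
  push_cast at h1
  exact (mul_left_cancel₀ h0 (by rw [← h1, mul_one]))

theorem sum_prod_kernel_mul [Nonempty X]
    (hc : ∀ h τ τ', (∀ k < h, τ k = τ' k) → c h τ = c h τ')
    (hc1 : ∀ h τ, ∑ x, c h τ x = 1) (h : Fin H) (φ : (Fin H → X) → ℝ) (G : X → ℝ)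
    (hφ : ∀ τ τ', (∀ k < h, τ k = τ' k) → φ τ = φ τ') :
    ∑ τ, (∏ k, c k τ (τ k)) * (φ τ * G (τ h)) =
      ∑ τ, (∏ k, c k τ (τ k)) * (φ τ * ∑ x, c h τ x * G x) := by
  have hX : (Fintype.card X : ℝ) ≠ 0 := by simp
  -- The two sides reduce to prefixes of lengths `h + 1` and `h`; the extra factor `card X` is the
  -- one in `card_mul_sum_kernel_step`.
  have h1 := sum_kernelProd_mul hc hc1 (H - (h + 1)) (h + 1) (by omega)
    (fun τ => φ τ * G (τ h)) (fun τ τ' hτ => by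
      rw [hτ h (by omega), hφ τ τ' fun k hk => hτ k (by have := Fin.lt_def.1 hk; omega)])
  have h2 := sum_kernelProd_mul hc hc1 (H - h) h (by omega)
    (fun τ => φ τ * ∑ x, c h τ x * G x) (fun τ τ' hτ => by
      rw [hc h τ τ' fun k hk => hτ k hk, hφ τ τ' fun k hk => hτ k hk])
  have h3 := card_mul_sum_kernel_step (c := c) h (fun τ => kernelProd c h τ * φ τ) G
    (fun τ x => by
      rw [kernelProd_update hc h τ x, hφ _ τ fun k hk => Function.update_of_ne hk.ne _ _])
    (fun τ x => hc _ _ _ fun k hk => Function.update_of_ne hk.ne _ _)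
  have h4 : ∑ τ, kernelProd c (h + 1) τ * (φ τ * G (τ h)) =
      ∑ τ, kernelProd c h τ * φ τ * (c h τ (τ h) * G (τ h)) :=
    Finset.sum_congr rfl fun τ _ => by rw [kernelProd_succ h τ]; ring
  have h5 : H - (h : ℕ) = (H - (h + 1)) + 1 := by omega
  simp only [mul_assoc] at h1 h2 h3 h4
  rw [← h4, h1, h2, h5, pow_succ', mul_assoc] at h3
  exact mul_left_cancel₀ (pow_ne_zero _ hX) (mul_left_cancel₀ hX h3)

end SequentialKernels

/-! ### Trajectory laws and the data collection round -/

namespace TabularMDP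

variable {S : Type u} {A : Type v} [Fintype S] [Fintype A] {H : ℕ}

theorem nonempty_state (M : TabularMDP S A H) : Nonempty S := by
  by_contra h
  rw [not_nonempty_iff] at h
  simpa using M.init_mem.2

/-- The state-action pair of `τ` at step `h`, with a default value past the horizon. -/
noncomputable def obsAt [Nonempty S] [Nonempty A] (h : ℕ) (τ : Trajectory S A H) : S × A :=
  if hh : h < H then τ ⟨h, hh⟩ else Classical.arbitrary _

/-- The transition kernel indexed by natural numbers. -/
noncomputable def transAt (M : TabularMDP S A H) (h : ℕ) (z : S × A) : S → ℝ :=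
  -- Past the horizon any probability vector would do.
  if hh : h < H then M.trans ⟨h, hh⟩ z.1 z.2 else M.init

/-- The reward indexed by natural numbers. -/
noncomputable def rewardAt (M : TabularMDP S A H) (h : ℕ) (z : S × A) : ℝ :=
  if hh : h < H then M.reward ⟨h, hh⟩ z.1 z.2 else 0

theorem transAt_mem (M : TabularMDP S A H) (h : ℕ) (z : S × A) :
    M.transAt h z ∈ stdSimplex ℝ S := by
  unfold transAt
  split_ifs
  · exact M.trans_mem _ _ _
  · exact M.init_mem

theorem rewardAt_mem (M : TabularMDP S A H) (h : ℕ) (z : S × A) :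
    M.rewardAt h z ∈ Set.Icc (0 : ℝ) 1 := by
  unfold rewardAt
  split_ifs
  · exact M.reward_mem _ _ _
  · simp

variable [Nonempty S] [Nonempty A]

omit [Fintype S] [Fintype A] in
theorem obsAt_fin (h : Fin H) (τ : Trajectory S A H) : obsAt (h : ℕ) τ = τ h := by
  simp [obsAt]

/-- The law of the state at step `h` given the earlier part of `τ`. -/
noncomputable def stateLaw (M : TabularMDP S A H) (h : ℕ) (τ : Trajectory S A H) : S → ℝ :=
  match h with
  | 0 => M.init
  | k + 1 => M.transAt k (obsAt k τ)

theorem stateLaw_mem (M : TabularMDP S A H) (h : ℕ) (τ : Trajectory S A H) :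
    M.stateLaw h τ ∈ stdSimplex ℝ S := by
  cases h
  · exact M.init_mem
  · exact M.transAt_mem _ _

theorem stateLaw_congr (M : TabularMDP S A H) {h : Fin H} {τ τ' : Trajectory S A H}
    (hτ : ∀ k < h, τ k = τ' k) : M.stateLaw h τ = M.stateLaw h τ' := by
  obtain ⟨_ | h, hh⟩ := h
  · rfl
  · have hh' : h < H := by omega
    simp only [stateLaw, obsAt, hh', dif_pos]
    rw [hτ ⟨h, hh'⟩ (Fin.mk_lt_mk.2 (Nat.lt_succ_self h))]

theorem stateProb_eq (M : TabularMDP S A H) (τ : Trajectory S A H) (h : Fin H) :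
    M.stateProb τ h = M.stateLaw h τ (τ h).1 := by
  obtain ⟨_ | h, hh⟩ := h
  · simp [stateProb, stateLaw]
  · have hh' : h < H := by omega
    simp [stateProb, stateLaw, transAt, obsAt, hh']

/-- The law of the state-action pair at step `h` given the earlier part of `τ`. -/
noncomputable def pairLaw (M : TabularMDP S A H) (π : TabularPolicy S A H) (h : Fin H)
    (τ : Trajectory S A H) (z : S × A) : ℝ :=
  M.stateLaw h τ z.1 * π.prob h z.1 z.2

theorem trajProb_eq (M : TabularMDP S A H) (π : TabularPolicy S A H) (τ : Trajectory S A H) :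
    M.trajProb π τ = ∏ h, M.pairLaw π h τ (τ h) :=
  Finset.prod_congr rfl fun h _ => by rw [stateProb_eq, pairLaw]

theorem pairLaw_congr (M : TabularMDP S A H) (π : TabularPolicy S A H) (h : Fin H)
    (τ τ' : Trajectory S A H) (hτ : ∀ k < h, τ k = τ' k) :
    M.pairLaw π h τ = M.pairLaw π h τ' := by
  funext z
  rw [pairLaw, pairLaw, M.stateLaw_congr hτ]

theorem sum_pairLaw_mul (M : TabularMDP S A H) (π : TabularPolicy S A H) (h : Fin H)
    (τ : Trajectory S A H) (G : S → ℝ) :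
    ∑ z, M.pairLaw π h τ z * G z.1 = ∑ s, M.stateLaw h τ s * G s := by
  rw [Fintype.sum_prod_type]
  refine Finset.sum_congr rfl fun s _ => ?_
  simp only [pairLaw]
  rw [← Finset.sum_mul, ← Finset.mul_sum, (π.prob_mem h s).2, mul_one]

theorem sum_pairLaw (M : TabularMDP S A H) (π : TabularPolicy S A H) (h : Fin H)
    (τ : Trajectory S A H) : ∑ z, M.pairLaw π h τ z = 1 := by
  simpa [(M.stateLaw_mem h τ).2] using M.sum_pairLaw_mul π h τ (fun _ => 1)

theorem trajProb_nonneg (M : TabularMDP S A H) (π : TabularPolicy S A H)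
    (τ : Trajectory S A H) : 0 ≤ M.trajProb π τ := by
  rw [trajProb_eq]
  exact Finset.prod_nonneg fun h _ => mul_nonneg ((M.stateLaw_mem h τ).1 _) ((π.prob_mem h _).1 _)

theorem sum_trajProb (M : TabularMDP S A H) (π : TabularPolicy S A H) :
    ∑ τ, M.trajProb π τ = 1 := by
  simp only [trajProb_eq]
  exact sum_prod_kernel_eq_one (M.pairLaw_congr π) (M.sum_pairLaw π)

theorem sum_trajProb_mul (M : TabularMDP S A H) (π : TabularPolicy S A H) (h : Fin H)
    (φ : Trajectory S A H → ℝ) (G : S × A → ℝ)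
    (hφ : ∀ τ τ', (∀ k < h, τ k = τ' k) → φ τ = φ τ') :
    ∑ τ, M.trajProb π τ * (φ τ * G (τ h)) =
      ∑ τ, M.trajProb π τ * (φ τ * ∑ z, M.pairLaw π h τ z * G z) := by
  simp only [trajProb_eq]
  exact sum_prod_kernel_mul (M.pairLaw_congr π) (M.sum_pairLaw π) h φ G hφ

theorem sum_trajProb_indicator_mul (M : TabularMDP S A H) (π : TabularPolicy S A H) {h : ℕ}
    (hh : h < H) (s : S) (φ : Trajectory S A H → ℝ)
    (hφ : ∀ τ τ', (∀ k < h, obsAt k τ = obsAt k τ') → φ τ = φ τ') :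
    ∑ τ, M.trajProb π τ * (Set.indicator {τ | (obsAt h τ).1 = s} 1 τ * φ τ) =
      ∑ τ, M.trajProb π τ * (M.stateLaw h τ s * φ τ) := by
  classical
  have h1 := M.sum_trajProb_mul π ⟨h, hh⟩ φ (fun z => if z.1 = s then 1 else 0)
    (fun τ τ' hτ => hφ τ τ' fun k hk => by
      simp only [obsAt, hk.trans hh, dif_pos]
      exact hτ _ (Fin.mk_lt_mk.2 hk))
  have h2 : ∀ τ, ∑ z : S × A, M.pairLaw π ⟨h, hh⟩ τ z * (if z.1 = s then 1 else 0) =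
      M.stateLaw h τ s := by
    intro τ
    have := M.sum_pairLaw_mul π ⟨h, hh⟩ τ (fun t => if t = s then 1 else 0)
    simpa using this
  simp only [h2] at h1
  refine Eq.trans ?_ (h1.trans ?_)
  · refine Finset.sum_congr rfl fun τ _ => ?_
    simp only [Set.indicator_apply, Set.mem_ofPred_eq, obsAt, hh, dif_pos, Pi.one_apply]
    ring
  · exact Finset.sum_congr rfl fun τ _ => by ring

theorem roundProb_nonneg (M : TabularMDP S A H) (πE πβ : TabularPolicy S A H) {η : ℝ}
    (h0 : 0 ≤ η) (h1 : η ≤ 1) (x : Bool × Trajectory S A H) : 0 ≤ M.roundProb πE πβ η x := by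
  unfold roundProb
  split_ifs
  · exact mul_nonneg h0 (M.trajProb_nonneg _ _)
  · exact mul_nonneg (sub_nonneg.2 h1) (M.trajProb_nonneg _ _)

omit [Nonempty S] [Nonempty A] in
theorem sum_roundProb_mul (M : TabularMDP S A H) (πE πβ : TabularPolicy S A H) (η : ℝ)
    (f : Bool × Trajectory S A H → ℝ) :
    ∑ x, M.roundProb πE πβ η x * f x =
      η * ∑ τ, M.trajProb πE τ * f (true, τ) +
        (1 - η) * ∑ τ, M.trajProb πβ τ * f (false, τ) := by
  rw [Fintype.sum_prod_type, Fintype.sum_bool]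
  simp [roundProb, Finset.mul_sum, mul_assoc]

/-- One data collection round as a controlled chain. -/
noncomputable def roundChain (M : TabularMDP S A H) (πE πβ : TabularPolicy S A H) {η : ℝ}
    (h0 : 0 ≤ η) (h1 : η ≤ 1) : ControlledChain (Bool × Trajectory S A H) S A H where
  weight := M.roundProb πE πβ η
  weight_nonneg := M.roundProb_nonneg πE πβ h0 h1
  weight_sum := by
    have := M.sum_roundProb_mul πE πβ η (fun _ => 1)
    simpa [sum_trajProb] using this
  obs h x := obsAt h x.2
  init := M.init
  init_mem := M.init_mem
  trans := M.transAt
  trans_mem := M.transAt_mem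
  markov := by
    -- The identity is linear in the law and both rollouts share the kernels, so it passes to the
    -- mixture.
    intro h hh s φ hφ
    rw [sum_roundProb_mul, sum_roundProb_mul]
    congr 2
    · exact M.sum_trajProb_indicator_mul πE hh s (fun τ => φ (true, τ))
        (fun τ τ' hτ => hφ _ _ hτ)
    · exact M.sum_trajProb_indicator_mul πβ hh s (fun τ => φ (false, τ))
        (fun τ τ' hτ => hφ _ _ hτ)

theorem value_eq (M : TabularMDP S A H) (π : TabularPolicy S A H) :
    M.value π = ∑ τ, M.trajProb π τ * ∑ h ∈ Finset.range H, M.rewardAt h (obsAt h τ) := by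
  refine Finset.sum_congr rfl fun τ _ => ?_
  rw [Finset.sum_range]
  simp [rewardAt, obsAt]

/-- The probability that a rollout of `π` is in state `s` at step `h`. -/
noncomputable def stateOcc (M : TabularMDP S A H) (π : TabularPolicy S A H) (h : ℕ) (s : S) : ℝ :=
  ∑ τ, M.trajProb π τ * M.stateLaw h τ s

theorem sum_trajProb_mul_obsAt (M : TabularMDP S A H) (π : TabularPolicy S A H) (h : Fin H)
    (G : S × A → ℝ) :
    ∑ τ, M.trajProb π τ * G (obsAt h τ) =
      ∑ s, ∑ a, M.stateOcc π h s * π.prob h s a * G (s, a) := by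
  have h1 := M.sum_trajProb_mul π h (fun _ => 1) G (fun _ _ _ => rfl)
  simp only [one_mul] at h1
  refine Eq.trans ?_ (Fintype.sum_prod_type fun z : S × A =>
    M.stateOcc π h z.1 * π.prob h z.1 z.2 * G z)
  simp only [obsAt_fin, h1, stateOcc, Finset.sum_mul, Finset.mul_sum]
  rw [Finset.sum_comm]
  refine Finset.sum_congr rfl fun z _ => Finset.sum_congr rfl fun τ _ => ?_
  simp only [pairLaw]
  ring

theorem stateOcc_succ (M : TabularMDP S A H) (π : TabularPolicy S A H) (h : ℕ) (s : S) :
    M.stateOcc π (h + 1) s = ∑ τ, M.trajProb π τ * M.transAt h (obsAt h τ) s := rfl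

theorem stateOcc_zero (M : TabularMDP S A H) (π : TabularPolicy S A H) (s : S) :
    M.stateOcc π 0 s = M.init s := by
  simp [stateOcc, stateLaw, ← Finset.sum_mul, sum_trajProb]

/-! ### The NBCU rollout dominates the capped flow -/

section Domination

variable {M : TabularMDP S A H} {πE πβ : TabularPolicy S A H} {η : ℝ} {h0 : 0 ≤ η} {h1 : η ≤ 1}
  {N : ℕ} (D : CollectedData S A H N)

omit [Fintype S] [Fintype A] [Nonempty S] [Nonempty A] in
theorem unionCount_eq_sum [DecidableEq (S × A)] (h : Fin H) (s : S) (a : A) :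
    (unionCount D h s a : ℝ) = ∑ j, if (D j).2 h = (s, a) then 1 else 0 := by
  classical
  rw [unionCount, Finset.card_filter]
  push_cast
  exact Finset.sum_congr rfl fun j _ => by congr

theorem sum_unionCount_mul (h : Fin H) (f : S × A → ℝ) :
    ∑ s, ∑ a, (unionCount D h s a : ℝ) * f (s, a) = ∑ j, f (obsAt h (D j).2) := by
  classical
  refine (Fintype.sum_prod_type fun z : S × A => (unionCount D h z.1 z.2 : ℝ) * f z).symm.trans ?_
  simp only [unionCount_eq_sum, Finset.sum_mul, obsAt_fin]
  rw [Finset.sum_comm]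
  exact Finset.sum_congr rfl fun j _ => by simp

theorem visits_roundChain (h : Fin H) (s : S) :
    (M.roundChain πE πβ h0 h1).visits D Finset.univ h s = unionStateCount D h s := by
  classical
  have h2 := sum_unionCount_mul D h (fun z => if z.1 = s then 1 else 0)
  rw [ControlledChain.visits]
  simp only [ControlledChain.ind_eq_ite]
  refine Eq.trans h2.symm ?_
  simp [unionStateCount]

omit [Fintype S] [Nonempty S] in
theorem unionStateCount_mul_nbcu_prob (h : Fin H) (s : S) (a : A) :
    (unionStateCount D h s : ℝ) * (nbcu D).prob h s a = unionCount D h s a := by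
  by_cases hs : 0 < unionStateCount D h s
  · have hs' : (unionStateCount D h s : ℝ) ≠ 0 := by exact_mod_cast hs.ne'
    simp only [nbcu, hs, if_true]
    field_simp
  · have hs0 : unionStateCount D h s = 0 := by omega
    have ha : unionCount D h s a = 0 :=
      (Finset.sum_eq_zero_iff_of_nonneg fun _ _ => Nat.zero_le _).1 hs0 a (Finset.mem_univ a)
    simp [hs0, ha]

/-- Since NBCU plays empirical frequencies, an even split of mass among the samples at `s`
distributes it over actions exactly as NBCU does; the cap only removes mass, and `G` is nonnegative.
-/
theorem sum_wt_mul_le (h : Fin H)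
    (hflow : ∀ s, (M.roundChain πE πβ h0 h1).flow D Finset.univ
      ((M.roundChain πE πβ h0 h1).wt D Finset.univ h) h s ≤ M.stateOcc (nbcu D) h s)
    {G : S × A → ℝ} (hG : ∀ z, 0 ≤ G z) :
    ∑ j, (M.roundChain πE πβ h0 h1).wt D Finset.univ (h + 1) (D j) * G (obsAt h (D j).2) ≤
      ∑ τ, M.trajProb (nbcu D) τ * G (obsAt h τ) := by
  rw [sum_trajProb_mul_obsAt]
  have e := sum_unionCount_mul D h (fun z => (M.roundChain πE πβ h0 h1).share D Finset.univ
    ((M.roundChain πE πβ h0 h1).wt D Finset.univ h) h z.1 * G z)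
  refine le_trans (le_of_eq e.symm) (Finset.sum_le_sum fun s _ => Finset.sum_le_sum fun a _ => ?_)
  rw [← unionStateCount_mul_nbcu_prob D h s a, ← visits_roundChain (M := M) (πE := πE)
    (πβ := πβ) (h0 := h0) (h1 := h1) D h s]
  have h2 := ((M.roundChain πE πβ h0 h1).visits_mul_share D Finset.univ
    ((M.roundChain πE πβ h0 h1).wt_nonneg D Finset.univ h) h s).trans_le
    ((min_le_left _ _).trans (hflow s))
  have h3 := mul_le_mul_of_nonneg_right h2
    (mul_nonneg (((nbcu D).prob_mem h s).1 a) (hG (s, a)))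
  refine le_trans (le_of_eq ?_) (h3.trans (le_of_eq ?_)) <;> ring

/-- The inductive step takes for `G` the probability of moving to `s`. -/
theorem flow_le_stateOcc (hN : 0 < N) (h : ℕ) (hh : h < H) (s : S) :
    (M.roundChain πE πβ h0 h1).flow D Finset.univ
      ((M.roundChain πE πβ h0 h1).wt D Finset.univ h) h s ≤ M.stateOcc (nbcu D) h s := by
  induction h generalizing s with
  | zero =>
    have hN' : (N : ℝ) ≠ 0 := by exact_mod_cast hN.ne'
    rw [stateOcc_zero]
    refine le_of_eq ?_
    simp only [ControlledChain.flow, ControlledChain.wt, ControlledChain.law,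
      Finset.sum_const, Finset.card_univ, Fintype.card_fin, nsmul_eq_mul, roundChain]
    field_simp
  | succ h ih =>
    rw [stateOcc_succ]
    exact sum_wt_mul_le D ⟨h, by omega⟩ (ih (by omega)) (G := fun z => M.transAt h z s)
      (fun z => (M.transAt_mem h z).1 s)

theorem sum_gain_le_value_nbcu (hN : 0 < N) :
    ∑ k ∈ Finset.range H, (M.roundChain πE πβ h0 h1).gain M.rewardAt D k ≤
      M.value (nbcu D) := by
  rw [value_eq]
  simp only [Finset.mul_sum]
  rw [Finset.sum_comm]
  refine Finset.sum_le_sum fun k hk => ?_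
  have hk' := Finset.mem_range.1 hk
  exact sum_wt_mul_le D ⟨k, hk'⟩ (flow_le_stateOcc D hN k hk') (fun z => (M.rewardAt_mem k z).1)

end Domination

/-! ### The two bounds and the choice of constants -/

omit [Nonempty S] [Nonempty A] in
theorem dataExpectation_eq (M : TabularMDP S A H) (πE πβ : TabularPolicy S A H) (η : ℝ) (N : ℕ)
    (f : CollectedData S A H N → ℝ) :
    M.dataExpectation πE πβ η N f = iidExpect (M.roundProb πE πβ η) N f := rfl

theorem value_nonneg (M : TabularMDP S A H) (π : TabularPolicy S A H) : 0 ≤ M.value π := by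
  rw [value_eq]
  exact Finset.sum_nonneg fun τ _ => mul_nonneg (M.trajProb_nonneg π τ)
    (Finset.sum_nonneg fun h _ => (M.rewardAt_mem h _).1)

theorem value_le (M : TabularMDP S A H) (π : TabularPolicy S A H) : M.value π ≤ H := by
  rw [value_eq]
  calc _ ≤ ∑ τ, M.trajProb π τ * (H : ℝ) := by
        refine Finset.sum_le_sum fun τ _ =>
          mul_le_mul_of_nonneg_left ?_ (M.trajProb_nonneg π τ)
        refine (Finset.sum_le_sum fun h _ => (M.rewardAt_mem h (obsAt h τ)).2).trans ?_
        simp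
    _ = H := by rw [← Finset.sum_mul, sum_trajProb, one_mul]

theorem dataExpectation_value_sub_nbcu_le (M : TabularMDP S A H) (πE πβ : TabularPolicy S A H)
    {η : ℝ} (h0 : 0 ≤ η) (h1 : η ≤ 1) {N : ℕ} (hN : 0 < N) :
    M.dataExpectation πE πβ η N (fun D => M.value πE - M.value (nbcu D)) ≤
      (1 - η) * (M.value πE - M.value πβ) + 11 * H * 2 ^ H * (Fintype.card S / N) := by
  set P := M.roundChain πE πβ h0 h1
  have e1 := P.sum_reward_sub_iidExpect_gain_le M.rewardAt_mem hN
  have e2 := M.sum_roundProb_mul πE πβ η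
    (fun x => ∑ k ∈ Finset.range H, M.rewardAt k (obsAt k x.2))
  rw [← value_eq, ← value_eq] at e2
  change ∑ x, M.roundProb πE πβ η x * ∑ k ∈ Finset.range H, M.rewardAt k (obsAt k x.2) - _ ≤ _
    at e1
  rw [e2] at e1
  have e3 := iidExpect_mono P.weight_nonneg (fun D : CollectedData S A H N =>
    sum_gain_le_value_nbcu (M := M) (πE := πE) (πβ := πβ) (h0 := h0) (h1 := h1) D hN)
  have e4 : M.dataExpectation πE πβ η N (fun D => M.value πE - M.value (nbcu D)) =
      M.value πE - iidExpect P.weight N (fun D => M.value (nbcu D)) := by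
    rw [dataExpectation_eq]
    change iidExpect P.weight N _ = _
    rw [iidExpect_sub, iidExpect_const P.weight_sum]
  rw [e4]
  linarith

theorem dataExpectation_value_sub_nbcu_le_horizon (M : TabularMDP S A H)
    (πE πβ : TabularPolicy S A H) {η : ℝ} (h0 : 0 ≤ η) (h1 : η ≤ 1) (N : ℕ) :
    M.dataExpectation πE πβ η N (fun D => M.value πE - M.value (nbcu D)) ≤ H := by
  rw [dataExpectation_eq]
  have hP := (M.roundChain πE πβ h0 h1).weight_sum
  refine (iidExpect_mono (M.roundProb_nonneg πE πβ h0 h1) (g := fun _ => (H : ℝ))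
    fun D => ?_).trans (iidExpect_const hP _).le
  linarith [M.value_le πE, M.value_nonneg (nbcu D)]

end TabularMDP

theorem mainTheorem1 :
    ∃ C : ℝ, 0 < C ∧ ∀ H : ℕ, ∃ n₀ : ℕ, 0 < n₀ ∧
      ∀ (S : Type u) (A : Type v) [Fintype S] [Fintype A] [Nonempty A]
        (M : TabularMDP S A H) (πE πβ : TabularPolicy S A H) (η : ℝ),
        0 < η → η ≤ 1 → ∀ N : ℕ, n₀ ≤ N →
          M.dataExpectation πE πβ η N (fun D => M.value πE - M.value (nbcu D)) ≤
            C * min (H : ℝ)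
              ((1 - η) * (M.value πE - M.value πβ) +
                (Fintype.card S : ℝ) * (H : ℝ) ^ 2 * Real.log (N : ℝ) / (N : ℝ)) := by
  -- This threshold gives `log N ≥ 11 * 2 ^ H`, so `C = 1` suffices.
  refine ⟨1, one_pos, fun H => ⟨⌈Real.exp (11 * 2 ^ H)⌉₊, Nat.ceil_pos.2 (Real.exp_pos _), ?_⟩⟩
  intro S A _ _ _ M πE πβ η hη hη1 N hN
  have := M.nonempty_state
  have hexp : Real.exp (11 * 2 ^ H) ≤ N := Nat.ceil_le.1 hN
  have hN0 : (0 : ℝ) < N := (Real.exp_pos _).trans_le hexp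
  have hlog : (11 : ℝ) * 2 ^ H ≤ Real.log N := (Real.le_log_iff_exp_le hN0).2 hexp
  rw [one_mul]
  refine le_min (M.dataExpectation_value_sub_nbcu_le_horizon πE πβ hη.le hη1 N)
    ((M.dataExpectation_value_sub_nbcu_le πE πβ hη.le hη1 (by exact_mod_cast hN0)).trans
      (add_le_add le_rfl ?_))
  -- The error is only linear in `H` apart from `2 ^ H`; integrality of `H` gives the square,
  -- including `H = 0`.
  have hH : (H : ℝ) ≤ (H : ℝ) ^ 2 := by exact_mod_cast Nat.le_self_pow two_ne_zero H
  calc (11 : ℝ) * H * 2 ^ H * (Fintype.card S / N)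
      = Fintype.card S * (H * (11 * 2 ^ H)) / N := by ring
    _ ≤ Fintype.card S * ((H : ℝ) ^ 2 * Real.log N) / N := by gcongr
    _ = _ := by ring
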